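/- Let $G=(V,E)$ be a finite simple graph with edge weights $w\in\mathbb R^E$. For $U\subseteq V$ let $\delta(U)$ be the set of edges with exactly one end in $U$. Edmonds' algorithm keeps a collection $\Omega$ of odd subsets of $V$, dual values $\pi(U)$ for the odd sets $U\subseteq V$, a matching $M$, and, for each $U\in\Omega$ with $|U|\ge 3$, the circuit whose shrinking created $U$, with its base. Dual values are called *feasible* if $\pi(U)\ge 0$ for all odd $U$ with $|U|\ge 3$ and $\sum_{U \text{ odd},\, e\in\delta(U)}\pi(U)\le w_e$ for all $e\in E$; an edge is *tight* if it satisfies the second constraint with equality. $\Omega_{\max}$ is the set of inclusion-wise maximal members of $\Omega$, and $G'$ is the graph of tight edges after shrinking each member of $\Omega_{\max}$ to a node; $M$ is a matching in $G'$, represented by edges of $G$, and $X\subseteq\Omega_{\max}$ is the set of nodes of $G'$ not covered by $M$. Initially $M=\emptyset$, $\Omega=\{\{v\}:v\in V\}$, and $\pi$ is feasible and vanishes outside $\Omega$. The steps are the following. 1. *Augment:* replace $M$ by $M\,\triangle\, E(P)$ for an $M$-alternating path $P$ in $G'$ between two different nodes of $X$. 2. *Shrink:* given an $M$-alternating walk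 $U_0,\dots,U_t$ in $G'$ with $U_0\in X$, $U_0,\dots,U_{t-1}$ distinct, $t$ odd and $U_t=U_i$ for some even $i<t$, add $U_i\cup\dots\cup U_{t-1}$ to $\Omega$, record its circuit $U_i,\dots,U_{t}$ with base $U_i$, and remove the edges of this circuit from $M$. 3. *Dual update:* only if $G'$ has no $M$-alternating walk of positive length from $X$ to $X$ (closed walks included). Let $\mathcal S$ (resp. $\mathcal T$) be the set of nodes of $G'$ reached from $X$ by an $M$-alternating path of odd (resp. even) length, length $0$ included. The values $\pi(U)$ are increased by amounts $\ge 0$ for $U\in\mathcal T$ and decreased by amounts $\ge 0$ for $U\in\mathcal S$, all other values being kept, so that $\pi$ stays feasible and the edges of $M$ stay tight. (Changing all these values by the largest possible common amount is one such choice.) 4. *Deshrink:* remove a set $U\in\Omega_{\max}$ with $|U|\ge 3$ and $\pi(U)=0$ from $\Omega$, and add to $M$ the perfect matching, consisting of edges of the recorded circuit $C$ of $U$, of $C$ minus the node at which the $M$-edge covering $U$ ends, or minus the base of $C$ if $M$ does not cover $U$. A *stage* is any state reached from an initial state by finitely many steps. At each stage let $\widetilde M$ be the matching obtained from $M$ by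 iteratively deshrinking sets of $\Omega_{\max}$ as in step 4, but regardless of their dual values, until $\Omega$ contains only singletons; and let $\pi^*(v)=\sum_{U \text{ odd},\, v\in U}\pi(U)$ for $v\in V$. Assume (Condition 1) that initially $\pi(\{v\})=\beta$ for all $v\in V$, with some fixed $\beta\in\mathbb R$, and $\pi(U)=0$ whenever $|U|\ge 3$, and that in each dual update all $\pi(U)$, $U\in\mathcal T$, are increased by the same amount. Then at every stage at least one matching $\widetilde M$ is obtained in this way, and for each $\widetilde M$ so obtained, every node $v\in V$ that is not covered by $\widetilde M$ has the maximum accumulated dual value: $$\pi^*(v)=\max_{u\in V}\pi^*(u).$$ -/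

import Mathlib

namespace Edmonds

/-- A (cyclically indexed) circuit of shrunken nodes: `edge j` joins `node j` and `node (j + 1)`
for `j + 1 < len`, and `edge (len - 1)` joins `node (len - 1)` and `node 0`. Only the indices below
`len` matter. -/
structure Circuit (V : Type*) where
  len : ℕ
  node : ℕ → Finset V
  edge : ℕ → Sym2 V

/-- For odd `C.len` and `j < C.len`: the perfect matching of the path `C - C.node j`, which consists
of every second edge of the circuit, starting with the edge from `C.node (j + 1)` to
`C.node (j + 2)`. -/
def Circuit.matchingAvoiding {V : Type*} [DecidableEq V] (C : Circuit V) (j : ℕ) :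
    Finset (Sym2 V) :=
  (Finset.range (C.len / 2)).image fun i => C.edge ((j + 1 + 2 * i) % C.len)

/-- A state of the algorithm. Edges of the shrunken graph are represented by the edges of the
original graph that they come from. -/
structure State (V : Type*) where
  /-- the laminar collection of odd sets -/
  Ω : Finset (Finset V)
  /-- the dual variables -/
  π : Finset V → ℝ
  /-- the current matching in the shrunken graph -/
  M : Finset (Sym2 V)
  /-- the circuit that was shrunk to create a non-singleton member of `Ω`; node `0` of the circuit
  is the base of the blossom -/
  circ : Finset V → Circuit V

/-- `e ∈ δ(U)` -/
def InCut {V : Type*} (e : Sym2 V) (U : Finset V) : Prop :=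
  ∃ x ∈ U, ∃ y, y ∉ U ∧ e = s(x, y)

open Classical in
/-- The left-hand side of the edge constraint: the sum of `π U` over the odd sets `U` with
`e ∈ δ(U)`. -/
noncomputable def cutDual {V : Type*} [Fintype V] (π : Finset V → ℝ) (e : Sym2 V) : ℝ :=
  ∑ U with Odd U.card ∧ InCut e U, π U

/-- The accumulated dual value `π*(v)`: the sum of `π U` over the odd sets `U` containing `v`. -/
noncomputable def accDual {V : Type*} [Fintype V] [DecidableEq V] (π : Finset V → ℝ) (v : V) : ℝ :=
  ∑ U with Odd U.card ∧ v ∈ U, π U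

/-- Dual feasibility. -/
def Feasible {V : Type*} [Fintype V] (G : SimpleGraph V) (w : Sym2 V → ℝ) (π : Finset V → ℝ) :
    Prop :=
  (∀ U : Finset V, Odd U.card → 3 ≤ U.card → 0 ≤ π U) ∧ ∀ e ∈ G.edgeSet, cutDual π e ≤ w e

/-- Tight edges. -/
def Tight {V : Type*} [Fintype V] (G : SimpleGraph V) (w : Sym2 V → ℝ) (π : Finset V → ℝ)
    (e : Sym2 V) : Prop :=
  e ∈ G.edgeSet ∧ cutDual π e = w e

namespace State

/-- `U ∈ Ω_max`, that is, `U` is a node of the shrunken graph `G'`. -/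
def IsNode {V : Type*} (s : State V) (U : Finset V) : Prop := Maximal (· ∈ s.Ω) U

/-- `U ∈ X`: `U` is a node of `G'` that is not matched by `M`. -/
def Unmatched {V : Type*} (s : State V) (U : Finset V) : Prop :=
  s.IsNode U ∧ ∀ e ∈ s.M, ¬ InCut e U

/-- `p 0, e 0, p 1, …, e (k - 1), p k` is an `M`-alternating walk of length `k` in the graph `G'` of
tight edges after shrinking the sets in `Ω_max`. -/
structure IsAltWalk {V : Type*} [Fintype V] (G : SimpleGraph V) (w : Sym2 V → ℝ) (s : State V)
    (k : ℕ) (p : ℕ → Finset V) (e : ℕ → Sym2 V) : Prop where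
  node : ∀ i ≤ k, s.IsNode (p i)
  ne : ∀ i < k, p i ≠ p (i + 1)
  tight : ∀ i < k, Tight G w s.π (e i)
  joins : ∀ i < k, ∃ x ∈ p i, ∃ y ∈ p (i + 1), e i = s(x, y)
  alternating : ∀ i, i + 1 < k → (e i ∈ s.M ↔ e (i + 1) ∉ s.M)

/-- The alternating walk is a path: it repeats no node. -/
structure IsAltPath {V : Type*} [Fintype V] (G : SimpleGraph V) (w : Sym2 V → ℝ) (s : State V)
    (k : ℕ) (p : ℕ → Finset V) (e : ℕ → Sym2 V) : Prop extends IsAltWalk G w s k p e where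
  inj : Set.InjOn p (Set.Iic k)

/-- `U ∈ 𝒮`: there is an alternating path of odd length from `X` to `U`. -/
def InS {V : Type*} [Fintype V] (G : SimpleGraph V) (w : Sym2 V → ℝ) (s : State V)
    (U : Finset V) : Prop :=
  ∃ k p e, IsAltPath G w s k p e ∧ s.Unmatched (p 0) ∧ p k = U ∧ Odd k

/-- `U ∈ 𝒯`: there is an alternating path of even length from `X` to `U`. -/
def InT {V : Type*} [Fintype V] (G : SimpleGraph V) (w : Sym2 V → ℝ) (s : State V)
    (U : Finset V) : Prop :=
  ∃ k p e, IsAltPath G w s k p e ∧ s.Unmatched (p 0) ∧ p k = U ∧ Even k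

/-- The initial states: the empty matching, only singletons in `Ω`, and a feasible dual vector
supported in `Ω`. -/
structure IsInitial {V : Type*} [Fintype V] [DecidableEq V] (G : SimpleGraph V) (w : Sym2 V → ℝ)
    (s : State V) : Prop where
  matching : s.M = ∅
  sets : s.Ω = Finset.univ.image fun v => {v}
  feasible : Feasible G w s.π
  support : ∀ U, U ∉ s.Ω → s.π U = 0

/-- Primal update, augmentation along a path of `G'` between two different nodes in `X`. -/
def Augment {V : Type*} [Fintype V] [DecidableEq V] (G : SimpleGraph V) (w : Sym2 V → ℝ)
    (s s' : State V) : Prop :=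
  ∃ k p e, IsAltPath G w s k p e ∧ 0 < k ∧ s.Unmatched (p 0) ∧ s.Unmatched (p k) ∧
    s' = { s with M := symmDiff s.M ((Finset.range k).image e) }

/-- Primal update, shrinking of a blossom. The walk `p 0, …, p t` is a flower: it starts in `X`, and
its first repetition of a node is `p t = p i` with `i` even and `t` odd. Its stem is `p 0, …, p i`
and its blossom is the odd circuit `p i, …, p t` with base `p i`. -/
def Shrink {V : Type*} [Fintype V] [DecidableEq V] (G : SimpleGraph V) (w : Sym2 V → ℝ)
    (s s' : State V) : Prop :=
  ∃ i t p e, IsAltWalk G w s t p e ∧ s.Unmatched (p 0) ∧ Set.InjOn p (Set.Iio t) ∧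
    i < t ∧ Even i ∧ Odd t ∧ p t = p i ∧
    s' = { Ω := insert ((Finset.Ico i t).biUnion p) s.Ω
           π := s.π
           M := s.M \ (Finset.Ico i t).image e
           circ := Function.update s.circ ((Finset.Ico i t).biUnion p)
             ⟨t - i, fun j => p (i + j), fun j => e (i + j)⟩ }

/-- Deshrinking the non-singleton node `U` of `G'`: `U` is removed from `Ω`, and `M` is extended by
the perfect matching of the circuit of `U` minus one of its nodes. That node is the one met by the
edge of `M` that covers `U`, and it is the base of the blossom if `M` does not cover `U`. -/
def Deshrink {V : Type*} [DecidableEq V] (U : Finset V) (s s' : State V) : Prop :=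
  s.IsNode U ∧ 3 ≤ U.card ∧ ∃ j < (s.circ U).len,
    ((∃ e ∈ s.M, ∃ x ∈ U, ∃ y, y ∉ U ∧ e = s(x, y) ∧ x ∈ (s.circ U).node j) ∨
      (s.Unmatched U ∧ j = 0)) ∧
    s' = { s with Ω := s.Ω.erase U, M := s.M ∪ (s.circ U).matchingAvoiding j }

/-- Dual update, which takes place if `G'` has no alternating walk of positive length from `X` to
`X`: the values on `𝒯` are increased and those on `𝒮` are decreased, all other values stay, and the
new values are feasible and keep the edges of `M` tight. The amounts may differ from node to
node. -/
def DualUpdate {V : Type*} [Fintype V] (G : SimpleGraph V) (w : Sym2 V → ℝ)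
    (s s' : State V) : Prop :=
  (¬ ∃ k p e, IsAltWalk G w s k p e ∧ 0 < k ∧ s.Unmatched (p 0) ∧ s.Unmatched (p k)) ∧
  ∃ (ε π' : Finset V → ℝ), (∀ U, 0 ≤ ε U) ∧
    (∀ U, InT G w s U → π' U = s.π U + ε U) ∧
    (∀ U, InS G w s U → π' U = s.π U - ε U) ∧
    (∀ U, ¬ InT G w s U → ¬ InS G w s U → π' U = s.π U) ∧
    Feasible G w π' ∧ (∀ e ∈ s.M, Tight G w π' e) ∧
    s' = { s with π := π' }

/-- One step of the algorithm. In the algorithm itself, deshrinking applies to sets whose dual value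
is `0`. -/
inductive Step {V : Type*} [Fintype V] [DecidableEq V] (G : SimpleGraph V) (w : Sym2 V → ℝ)
    (s s' : State V) : Prop
  | augment (h : Augment G w s s')
  | shrink (h : Shrink G w s s')
  | dualUpdate (h : DualUpdate G w s s')
  | deshrink (U : Finset V) (hU : s.π U = 0) (h : Deshrink U s s')

/-- `N` is the matching `M̃` of the original graph obtained from the current matching `M` by
iteratively deshrinking the sets in `Ω_max` (whatever their dual values are) until only singletons
are left. -/
def Expands {V : Type*} [DecidableEq V] (s : State V) (N : Finset (Sym2 V)) : Prop :=
  ∃ t : State V, Relation.ReflTransGen (fun a b => ∃ U, Deshrink U a b) s t ∧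
    (∀ U ∈ t.Ω, U.card = 1) ∧ t.M = N

end State

/-- `σ 0, …, σ n` are the stages of a run of the algorithm. -/
structure IsRun {V : Type*} [Fintype V] [DecidableEq V] (G : SimpleGraph V) (w : Sym2 V → ℝ)
    (n : ℕ) (σ : ℕ → State V) : Prop where
  initial : (σ 0).IsInitial G w
  step : ∀ i < n, State.Step G w (σ i) (σ (i + 1))

/-- The condition on a run that all singletons start with the same dual value `β` and all larger
sets with `0`, and that each dual update increases the values on `𝒯` by the same amount. -/
structure UniformDuals {V : Type*} [Fintype V] (G : SimpleGraph V) (w : Sym2 V → ℝ)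
    (n : ℕ) (σ : ℕ → State V) : Prop where
  init : ∃ β : ℝ, (∀ v, (σ 0).π {v} = β) ∧ ∀ U : Finset V, 3 ≤ U.card → (σ 0).π U = 0
  step : ∀ i < n, State.DualUpdate G w (σ i) (σ (i + 1)) →
    ∃ α : ℝ, ∀ U, State.InT G w (σ i) U → (σ (i + 1)).π U = (σ i).π U + α

end Edmonds

namespace Edmonds

/-! The proof carries an invariant, `State.IsBound`, through the run: some real `B` bounds all
accumulated dual values, and it is attained at the base vertex of every unmatched node, where the
base vertex is found by descending from each blossom to the base node of its circuit.

Primal steps and deshrinking leave the dual values alone, so only the bases of unmatched nodes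
matter there. Augmenting creates no unmatched node (`Unmatched.of_augment`). A shrunken blossom can
be unmatched only if its base node already was, and it inherits that base vertex
(`IsFlower.unmatched_shrunk`). Deshrinking an unmatched blossom leaves only its base node uncovered
(`deshrink_edges`). In a dual update, a vertex changes by the amount of the unique node containing
it (`WellNested.accDual_sub`); unmatched nodes lie in 𝒯 and rise by the common amount `α`, while no
node rises by more, so `B + α` works.

Since deshrinking preserves the invariant whatever the dual value of the set, the invariant also
holds after full expansion. There every node is a singleton, its own base, so an uncovered vertex
attains `B`. -/

variable {V : Type*}

/-! ### Edges, cuts and vertex sets -/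

/-- The edge `e` joins a vertex of `A` to a vertex of `B`. -/
def Joins (e : Sym2 V) (A B : Finset V) : Prop := ∃ x ∈ A, ∃ y ∈ B, e = s(x, y)

theorem Joins.symm {e : Sym2 V} {A B : Finset V} (h : Joins e A B) : Joins e B A := by
  obtain ⟨x, hx, y, hy, rfl⟩ := h
  exact ⟨y, hy, x, hx, Sym2.eq_swap⟩

theorem Joins.inCut_left {e : Sym2 V} {A B : Finset V} (h : Joins e A B) (hd : Disjoint A B) :
    InCut e A := by
  obtain ⟨x, hx, y, hy, rfl⟩ := h
  exact ⟨x, hx, y, fun hy' => Finset.disjoint_left.1 hd hy' hy, rfl⟩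

theorem Joins.inCut_right {e : Sym2 V} {A B : Finset V} (h : Joins e A B) (hd : Disjoint A B) :
    InCut e B :=
  h.symm.inCut_left hd.symm

theorem InCut.exists_mem {e : Sym2 V} {U : Finset V} (h : InCut e U) : ∃ x ∈ e, x ∈ U := by
  obtain ⟨x, hx, y, -, rfl⟩ := h
  exact ⟨x, Sym2.mem_mk_left x y, hx⟩

theorem Joins.mem_or_mem {e : Sym2 V} {A B : Finset V} (h : Joins e A B) {x : V} (hx : x ∈ e) :
    x ∈ A ∨ x ∈ B := by
  obtain ⟨a, ha, b, hb, rfl⟩ := h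
  rcases Sym2.mem_iff.1 hx with rfl | rfl
  · exact Or.inl ha
  · exact Or.inr hb

/-- If `e` crosses `U`, then it crosses every subset of `U` that it meets. -/
theorem InCut.mono {e : Sym2 V} {U W : Finset V} (h : InCut e U) (hW : W ⊆ U) {x : V} (hx : x ∈ e)
    (hxW : x ∈ W) : InCut e W := by
  obtain ⟨a, -, b, hb, rfl⟩ := h
  rcases Sym2.mem_iff.1 hx with rfl | rfl
  · exact ⟨x, hxW, b, fun h => hb (hW h), rfl⟩
  · exact absurd (hW hxW) hb

theorem InCut.eq_of_mem {e : Sym2 V} {U : Finset V} (h : InCut e U) {x y : V} (hx : x ∈ e)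
    (hy : y ∈ e) (hxU : x ∈ U) (hyU : y ∈ U) : x = y := by
  obtain ⟨a, -, b, hb, rfl⟩ := h
  rcases Sym2.mem_iff.1 hx with rfl | rfl
  · rcases Sym2.mem_iff.1 hy with rfl | rfl
    · rfl
    · exact absurd hyU hb
  · exact absurd hxU hb

/-! ### Blossoms, base vertices and structural invariants -/

/-- The circuit `C` consists of an odd number of disjoint members of `Ω` with union `U`, and these
are the maximal members of `Ω` properly inside `U`. -/
structure IsBlossom (Ω : Finset (Finset V)) (C : Circuit V) (U : Finset V) : Prop where
  odd : Odd C.len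
  one_lt : 1 < C.len
  node_mem : ∀ j < C.len, C.node j ∈ Ω
  disjoint : ∀ i < C.len, ∀ j < C.len, i ≠ j → Disjoint (C.node i) (C.node j)
  mem_iff : ∀ x, x ∈ U ↔ ∃ j < C.len, x ∈ C.node j
  joins : ∀ j < C.len, Joins (C.edge j) (C.node j) (C.node ((j + 1) % C.len))
  maximal : ∀ W ∈ Ω, W ⊂ U → ∃ j < C.len, W ⊆ C.node j

theorem IsBlossom.node_subset {Ω : Finset (Finset V)} {C : Circuit V} {U : Finset V}
    (h : IsBlossom Ω C U) {j : ℕ} (hj : j < C.len) : C.node j ⊆ U :=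
  fun _ hx => (h.mem_iff _).2 ⟨j, hj, hx⟩

/-- The base vertices of blossoms, reached by passing from blossoms to their base nodes. -/
inductive IsBase (c : Finset V → Circuit V) : Finset V → V → Prop
  | single (v : V) : IsBase c {v} v
  | blossom (U : Finset V) (v : V) (hU : 3 ≤ U.card) (h : IsBase c ((c U).node 0) v) : IsBase c U v

namespace State

/-- `Ω` is a laminar family of odd sets that contains all singletons, and its larger members are
blossoms with respect to the recorded circuits. -/
structure WellNested (s : State V) : Prop where
  odd : ∀ U ∈ s.Ω, Odd U.card
  single : ∀ v, {v} ∈ s.Ω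
  laminar : ∀ U ∈ s.Ω, ∀ W ∈ s.Ω, U ⊆ W ∨ W ⊆ U ∨ Disjoint U W
  blossom : ∀ U ∈ s.Ω, 3 ≤ U.card → IsBlossom s.Ω (s.circ U) U

/-- `M` is a matching in the graph obtained by shrinking the members of `Ω_max`. -/
structure IsMatching (s : State V) : Prop where
  inCut : ∀ U, s.IsNode U → ∀ e ∈ s.M, ∀ x ∈ e, x ∈ U → InCut e U
  unique : ∀ U, s.IsNode U → ∀ e ∈ s.M, ∀ f ∈ s.M, InCut e U → InCut f U → e = f

theorem WellNested.nonempty {s : State V} (h : s.WellNested) {U : Finset V} (hU : U ∈ s.Ω) :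
    U.Nonempty :=
  Finset.card_pos.1 (h.odd U hU).pos

theorem WellNested.disjoint {s : State V} (h : s.WellNested) {U W : Finset V} (hU : s.IsNode U)
    (hW : s.IsNode W) (hne : U ≠ W) : Disjoint U W := by
  rcases h.laminar U hU.1 W hW.1 with h1 | h1 | h1
  · exact absurd (hU.eq_of_le hW.1 h1) hne
  · exact absurd (hW.eq_of_le hU.1 h1).symm hne
  · exact h1

theorem WellNested.node_eq {s : State V} (h : s.WellNested) {U W : Finset V} (hU : s.IsNode U)
    (hW : s.IsNode W) {x : V} (hxU : x ∈ U) (hxW : x ∈ W) : U = W := by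
  by_contra hne
  exact Finset.disjoint_left.1 (h.disjoint hU hW hne) hxU hxW

theorem exists_isNode_of_mem {s : State V} {U : Finset V} (hU : U ∈ s.Ω) :
    ∃ W, s.IsNode W ∧ U ⊆ W := by
  obtain ⟨W, h1, h2⟩ := s.Ω.exists_le_maximal hU
  exact ⟨W, h2, h1⟩

theorem WellNested.exists_isNode {s : State V} (h : s.WellNested) (v : V) :
    ∃ W, s.IsNode W ∧ v ∈ W := by
  obtain ⟨W, h1, h2⟩ := exists_isNode_of_mem (h.single v)
  exact ⟨W, h1, h2 (Finset.mem_singleton_self v)⟩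

theorem WellNested.eq_or_eq {s : State V} (h : s.WellNested) {U A B : Finset V} (hU : s.IsNode U)
    (hA : s.IsNode A) (hB : s.IsNode B) {e : Sym2 V} (he : Joins e A B) {x : V} (hx : x ∈ e)
    (hxU : x ∈ U) : U = A ∨ U = B :=
  (he.mem_or_mem hx).imp (h.node_eq hU hA hxU) (h.node_eq hU hB hxU)

/-- An edge joining two different nodes crosses every node that it meets. -/
theorem WellNested.inCut_of_joins {s : State V} (h : s.WellNested) {U A B : Finset V}
    (hU : s.IsNode U) (hA : s.IsNode A) (hB : s.IsNode B) (hne : A ≠ B) {e : Sym2 V}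
    (he : Joins e A B) {x : V} (hx : x ∈ e) (hxU : x ∈ U) : InCut e U := by
  rcases h.eq_or_eq hU hA hB he hx hxU with rfl | rfl
  · exact he.inCut_left (h.disjoint hA hB hne)
  · exact he.inCut_right (h.disjoint hA hB hne)

/-! ### Alternating walks -/

section Walk

variable [Fintype V] {G : SimpleGraph V} {w : Sym2 V → ℝ} {s : State V} {k : ℕ}
  {p : ℕ → Finset V} {e : ℕ → Sym2 V}

theorem IsAltWalk.inCut_left (h : IsAltWalk G w s k p e) (hs : s.WellNested) {i : ℕ} (hi : i < k) :
    InCut (e i) (p i) :=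
  Joins.inCut_left (h.joins i hi) (hs.disjoint (h.node i hi.le) (h.node (i + 1) hi) (h.ne i hi))

theorem IsAltWalk.inCut_right (h : IsAltWalk G w s k p e) (hs : s.WellNested) {i : ℕ}
    (hi : i < k) : InCut (e i) (p (i + 1)) :=
  Joins.inCut_right (h.joins i hi) (hs.disjoint (h.node i hi.le) (h.node (i + 1) hi) (h.ne i hi))

theorem IsAltWalk.eq_or_eq (h : IsAltWalk G w s k p e) (hs : s.WellNested) {i : ℕ} (hi : i < k)
    {U : Finset V} (hU : s.IsNode U) {x : V} (hx : x ∈ e i) (hxU : x ∈ U) :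
    U = p i ∨ U = p (i + 1) :=
  hs.eq_or_eq hU (h.node i hi.le) (h.node (i + 1) hi) (h.joins i hi) hx hxU

/-- The first edge leaves an unmatched node, so it is not in `M`; alternation fixes the rest by
parity. -/
theorem IsAltWalk.mem_iff_odd (h : IsAltWalk G w s k p e) (hs : s.WellNested)
    (h0 : s.Unmatched (p 0)) {i : ℕ} (hi : i < k) : e i ∈ s.M ↔ Odd i := by
  induction i with
  | zero => exact iff_of_false (fun hm => h0.2 _ hm (h.inCut_left hs hi)) (by decide)
  | succ i ih =>
    have h1 := ih (by omega)
    have h2 := h.alternating i hi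
    rw [Nat.odd_add_one]
    tauto

/-- One of the two walk edges at an interior node is in `M`, and a node has at most one matching
edge. -/
theorem IsAltWalk.eq_of_inCut (h : IsAltWalk G w s k p e) (hs : s.WellNested) (hM : s.IsMatching)
    {i : ℕ} (hi : i + 1 < k) {f : Sym2 V} (hf : f ∈ s.M) (hc : InCut f (p (i + 1))) :
    f = e i ∨ f = e (i + 1) := by
  have hn := h.node (i + 1) hi.le
  by_cases hm : e i ∈ s.M
  · exact Or.inl (hM.unique _ hn _ hf _ hm hc (h.inCut_right hs (by omega)))
  · have hm' : e (i + 1) ∈ s.M := by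
      have := h.alternating i hi
      tauto
    exact Or.inr (hM.unique _ hn _ hf _ hm' hc (h.inCut_left hs hi))

/-- The path of length `0` is the witness. This is why a dual update raises every unmatched node. -/
theorem WellNested.inT_of_unmatched (hs : s.WellNested) {U : Finset V} (h : s.Unmatched U) :
    InT G w s U := by
  obtain ⟨x, -⟩ := hs.nonempty h.1.1
  refine ⟨0, fun _ => U, fun _ => s(x, x), ⟨⟨fun _ _ => h.1, ?_, ?_, ?_, ?_⟩, ?_⟩, h, rfl,
    Even.zero⟩
  · exact fun i hi => absurd hi (Nat.not_lt_zero i)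
  · exact fun i hi => absurd hi (Nat.not_lt_zero i)
  · exact fun i hi => absurd hi (Nat.not_lt_zero i)
  · exact fun i hi => absurd hi (Nat.not_lt_zero _)
  · intro a ha b hb _
    rw [Nat.le_zero.1 ha, Nat.le_zero.1 hb]

end Walk

/-! ### Augmentation -/

theorem WellNested.of_eq {s s' : State V} (h : s.WellNested) (hΩ : s'.Ω = s.Ω)
    (hc : s'.circ = s.circ) : s'.WellNested := by
  obtain ⟨h1, h2, h3, h4⟩ := h
  constructor <;> simpa only [hΩ, hc]

section Augment

variable [Fintype V] [DecidableEq V] {G : SimpleGraph V} {w : Sym2 V → ℝ} {s s' : State V}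

/-- Matching edges off the path miss all its nodes: interior nodes have their matching edge on the
path, and the ends have none. The added edges are those of even index, which share no node. -/
theorem IsMatching.augment (hs : s.WellNested) (hM : s.IsMatching) (h : Augment G w s s') :
    s'.IsMatching := by
  obtain ⟨k, p, e, hp, hk, h0, h1, rfl⟩ := h
  have hw := hp.toIsAltWalk
  have path_of_inCut : ∀ i ≤ k, ∀ f ∈ s.M, InCut f (p i) → f ∈ (Finset.range k).image e := by
    intro i hi f hf hc
    rcases i with _ | i
    · exact absurd hc (h0.2 f hf)
    rcases hi.lt_or_eq with hi | rfl
    · rcases hw.eq_of_inCut hs hM hi hf hc with rfl | rfl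
      · exact Finset.mem_image_of_mem e (Finset.mem_range.2 (by omega))
      · exact Finset.mem_image_of_mem e (Finset.mem_range.2 (by omega))
    · exact absurd hc (h1.2 f hf)
  have old_new : ∀ U, s.IsNode U → ∀ f ∈ s.M, f ∉ (Finset.range k).image e → InCut f U →
      ∀ i < k, ¬ InCut (e i) U := by
    intro U hU f hf hfP hc i hi hc'
    obtain ⟨x, hx, hxU⟩ := hc'.exists_mem
    rcases hw.eq_or_eq hs hi hU hx hxU with rfl | rfl
    · exact hfP (path_of_inCut _ hi.le f hf hc)
    · exact hfP (path_of_inCut _ hi f hf hc)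
  constructor
  · intro U hU f hf x hx hxU
    rcases Finset.mem_symmDiff.1 hf with ⟨hf, -⟩ | ⟨hf, -⟩
    · exact hM.inCut U hU f hf x hx hxU
    · obtain ⟨i, hi, rfl⟩ := Finset.mem_image.1 hf
      have hi := Finset.mem_range.1 hi
      exact hs.inCut_of_joins hU (hw.node i hi.le) (hw.node (i + 1) hi) (hw.ne i hi)
        (hw.joins i hi) hx hxU
  · intro U hU f hf g hg hfU hgU
    have hU : s.IsNode U := hU
    rcases Finset.mem_symmDiff.1 hf with ⟨hf, hf'⟩ | ⟨hf, hf'⟩ <;>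
      rcases Finset.mem_symmDiff.1 hg with ⟨hg, hg'⟩ | ⟨hg, hg'⟩
    · exact hM.unique U hU f hf g hg hfU hgU
    · obtain ⟨i, hi, rfl⟩ := Finset.mem_image.1 hg
      exact absurd hgU (old_new U hU f hf hf' hfU i (Finset.mem_range.1 hi))
    · obtain ⟨i, hi, rfl⟩ := Finset.mem_image.1 hf
      exact absurd hfU (old_new U hU g hg hg' hgU i (Finset.mem_range.1 hi))
    · obtain ⟨i, hi, rfl⟩ := Finset.mem_image.1 hf
      obtain ⟨j, hj, rfl⟩ := Finset.mem_image.1 hg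
      have hi := Finset.mem_range.1 hi
      have hj := Finset.mem_range.1 hj
      rw [hw.mem_iff_odd hs h0 hi, Nat.not_odd_iff] at hf'
      rw [hw.mem_iff_odd hs h0 hj, Nat.not_odd_iff] at hg'
      obtain ⟨x, hx, hxU⟩ := hfU.exists_mem
      obtain ⟨y, hy, hyU⟩ := hgU.exists_mem
      have key : ∀ a ≤ k, ∀ b ≤ k, U = p a → U = p b → a = b := fun a ha b hb h1 h2 =>
        hp.inj ha hb (h1.symm.trans h2)
      have : i = j := by
        -- Both indices are even, so a common end of the two edges forces `i = j`.
        rcases hw.eq_or_eq hs hi hU hx hxU with h2 | h2 <;>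
          rcases hw.eq_or_eq hs hj hU hy hyU with h3 | h3 <;>
          have := key _ (by omega) _ (by omega) h2 h3 <;> omega
      rw [this]

/-- A node that loses a matching edge, necessarily of odd index, gains the neighbouring path edge of
even index. -/
theorem Unmatched.of_augment (hs : s.WellNested) (h : Augment G w s s') {U : Finset V}
    (hU : s'.Unmatched U) : s.Unmatched U := by
  obtain ⟨k, p, e, hp, hk, h0, h1, rfl⟩ := h
  have hw := hp.toIsAltWalk
  refine ⟨hU.1, fun f hf hc => ?_⟩
  by_cases hfP : f ∈ (Finset.range k).image e
  · obtain ⟨i, hi, rfl⟩ := Finset.mem_image.1 hfP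
    have hi := Finset.mem_range.1 hi
    have hodd := (hw.mem_iff_odd hs h0 hi).1 hf
    have new : ∀ j < k, ¬ Odd j → ¬ InCut (e j) U := by
      intro j hj hjo
      exact hU.2 _ (Finset.mem_symmDiff.2 (Or.inr
        ⟨Finset.mem_image_of_mem e (Finset.mem_range.2 hj),
          fun hm => hjo ((hw.mem_iff_odd hs h0 hj).1 hm)⟩))
    obtain ⟨x, hx, hxU⟩ := hc.exists_mem
    obtain ⟨a, rfl⟩ := hodd
    rcases hw.eq_or_eq hs hi hU.1 hx hxU with rfl | rfl
    · exact new (2 * a) (by omega) (by simp) (hw.inCut_right hs (by omega))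
    -- If no edge follows, the node is the end of the path, which was unmatched.
    · rcases Nat.lt_or_ge (2 * a + 1 + 1) k with h2 | h2
      · exact new (2 * a + 1 + 1) h2 (by simp [Nat.odd_add_one]) (hw.inCut_left hs h2)
      · have h3 : k = 2 * a + 1 + 1 := by omega
        subst h3
        exact h1.2 _ hf hc
  · exact hU.2 f (Finset.mem_symmDiff.2 (Or.inl ⟨hf, hfP⟩)) hc

end Augment

/-! ### Shrinking -/

section Shrink

variable [Fintype V] {G : SimpleGraph V} {w : Sym2 V → ℝ} {s : State V} {i t : ℕ}
  {p : ℕ → Finset V} {e : ℕ → Sym2 V}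

/-- The result of shrinking the circuit `p i, …, p t`. -/
def shrunk [DecidableEq V] (s : State V) (i t : ℕ) (p : ℕ → Finset V) (e : ℕ → Sym2 V) :
    State V where
  Ω := insert ((Finset.Ico i t).biUnion p) s.Ω
  π := s.π
  M := s.M \ (Finset.Ico i t).image e
  circ := Function.update s.circ ((Finset.Ico i t).biUnion p)
    ⟨t - i, fun j => p (i + j), fun j => e (i + j)⟩

/-- `p 0, …, p t` is a flower whose blossom is the circuit `p i, …, p t`. -/
structure IsFlower (G : SimpleGraph V) (w : Sym2 V → ℝ) (s : State V) (i t : ℕ)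
    (p : ℕ → Finset V) (e : ℕ → Sym2 V) : Prop where
  walk : IsAltWalk G w s t p e
  unmatched : s.Unmatched (p 0)
  inj : Set.InjOn p (Set.Iio t)
  lt : i < t
  even : Even i
  odd : Odd t
  close : p t = p i

theorem IsFlower.add_two_lt (h : IsFlower G w s i t p e) : i + 2 < t := by
  obtain ⟨a, ha⟩ := h.even
  obtain ⟨b, hb⟩ := h.odd
  have h1 := h.lt
  have h2 : i + 1 ≠ t := by
    rintro rfl
    exact h.walk.ne i (by omega) h.close.symm
  omega

theorem IsFlower.disjoint (h : IsFlower G w s i t p e) (hs : s.WellNested) {a b : ℕ} (ha : a < t)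
    (hb : b < t) (hab : a ≠ b) : Disjoint (p a) (p b) :=
  hs.disjoint (h.walk.node a ha.le) (h.walk.node b hb.le) fun h' => hab (h.inj ha hb h')

variable [DecidableEq V]

theorem IsFlower.subset (_ : IsFlower G w s i t p e) {a : ℕ} (hia : i ≤ a) (hat : a < t) :
    p a ⊆ (Finset.Ico i t).biUnion p :=
  Finset.subset_biUnion_of_mem p (Finset.mem_Ico.2 ⟨hia, hat⟩)

/-- A member of `Ω` containing the blossom would equal each of its circuit nodes by maximality, yet
consecutive nodes differ. -/
theorem IsFlower.not_subset (h : IsFlower G w s i t p e) {W : Finset V}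
    (hW : W ∈ s.Ω) : ¬ (Finset.Ico i t).biUnion p ⊆ W := by
  intro hsub
  have h1 := h.add_two_lt
  have h2 : ∀ a, i ≤ a → a < t → p a = W := fun a hia hat =>
    (h.walk.node a hat.le).eq_of_le hW ((h.subset hia hat).trans hsub)
  exact h.walk.ne i h.lt ((h2 i le_rfl h.lt).trans (h2 (i + 1) (by omega) (by omega)).symm)

theorem IsFlower.notMem (h : IsFlower G w s i t p e) :
    (Finset.Ico i t).biUnion p ∉ s.Ω :=
  fun hm => h.not_subset hm subset_rfl

/-- The maximal set above `W` is either a circuit node or disjoint from all of them. Laminarity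
after shrinking follows from this. -/
theorem IsFlower.node_subset_or_disjoint (h : IsFlower G w s i t p e) (hs : s.WellNested)
    {W : Finset V} (hW : W ∈ s.Ω) :
    (∃ a, i ≤ a ∧ a < t ∧ W ⊆ p a) ∨ Disjoint W ((Finset.Ico i t).biUnion p) := by
  obtain ⟨T, hT, hWT⟩ := exists_isNode_of_mem hW
  by_cases hex : ∃ a, i ≤ a ∧ a < t ∧ T = p a
  · obtain ⟨a, h1, h2, rfl⟩ := hex
    exact Or.inl ⟨a, h1, h2, hWT⟩
  · right
    rw [Finset.disjoint_biUnion_right]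
    intro a ha
    rw [Finset.mem_Ico] at ha
    exact (hs.disjoint hT (h.walk.node a ha.2.le)
      fun h' => hex ⟨a, ha.1, ha.2, h'⟩).mono_left hWT

/-- The blossom is a disjoint union of an odd number, `t - i`, of odd sets. -/
theorem IsFlower.card_odd (h : IsFlower G w s i t p e) (hs : s.WellNested) :
    Odd ((Finset.Ico i t).biUnion p).card := by
  rw [Finset.card_biUnion fun a ha b hb hab =>
    h.disjoint hs (Finset.mem_Ico.1 ha).2 (Finset.mem_Ico.1 hb).2 hab,
    Finset.odd_sum_iff_odd_card_odd, Finset.filter_true_of_mem fun a ha =>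
    hs.odd _ (h.walk.node a (Finset.mem_Ico.1 ha).2.le).1, Nat.card_Ico]
  exact Nat.Odd.sub_even h.lt.le h.odd h.even

theorem IsFlower.isBlossom (h : IsFlower G w s i t p e) (hs : s.WellNested) :
    IsBlossom (insert ((Finset.Ico i t).biUnion p) s.Ω)
      ⟨t - i, fun j => p (i + j), fun j => e (i + j)⟩ ((Finset.Ico i t).biUnion p) := by
  have h1 := h.add_two_lt
  refine ⟨Nat.Odd.sub_even h.lt.le h.odd h.even, ?_, ?_, ?_, ?_, ?_, ?_⟩
  · show 1 < t - i
    omega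
  · intro j (hj : j < t - i)
    exact Finset.mem_insert_of_mem (h.walk.node _ (by omega)).1
  · intro a (ha : a < t - i) b (hb : b < t - i) hab
    exact h.disjoint hs (by omega) (by omega) (by omega)
  · intro x
    rw [Finset.mem_biUnion]
    constructor
    · rintro ⟨a, ha, hx⟩
      rw [Finset.mem_Ico] at ha
      refine ⟨a - i, by show a - i < t - i; omega, ?_⟩
      show x ∈ p (i + (a - i))
      rwa [Nat.add_sub_cancel' ha.1]
    · rintro ⟨a, ha, hx⟩
      have ha : a < t - i := ha
      exact ⟨i + a, Finset.mem_Ico.2 ⟨by omega, by omega⟩, hx⟩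
  · intro j (hj : j < t - i)
    have h2 := h.walk.joins (i + j) (by omega)
    show Joins (e (i + j)) (p (i + j)) (p (i + (j + 1) % (t - i)))
    -- The index wraps around only at the last edge, where `p t = p i` closes the circuit.
    have h3 : p (i + (j + 1) % (t - i)) = p (i + j + 1) := by
      rcases (show j + 1 ≤ t - i from hj).lt_or_eq with hlt | heq
      · rw [Nat.mod_eq_of_lt hlt, add_assoc]
      · rw [heq, Nat.mod_self, add_zero, add_assoc, heq, Nat.add_sub_cancel' h.lt.le, h.close]
    rw [h3]
    exact h2
  · intro W hW hss
    rcases Finset.mem_insert.1 hW with rfl | hW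
    · exact absurd hss (ssubset_irrefl _)
    rcases h.node_subset_or_disjoint hs hW with ⟨a, h2, h3, h4⟩ | hd
    · refine ⟨a - i, by show a - i < t - i; omega, ?_⟩
      show W ⊆ p (i + (a - i))
      rwa [Nat.add_sub_cancel' h2]
    · obtain ⟨x, hx⟩ := hs.nonempty hW
      exact absurd (hss.1 hx) (Finset.disjoint_left.1 hd hx)

theorem IsFlower.circ_of_mem (h : IsFlower G w s i t p e) {W : Finset V} (hW : W ∈ s.Ω) :
    (s.shrunk i t p e).circ W = s.circ W :=
  Function.update_of_ne (ne_of_mem_of_not_mem hW h.notMem) _ _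

theorem IsFlower.wellNested (h : IsFlower G w s i t p e) (hs : s.WellNested) :
    (s.shrunk i t p e).WellNested := by
  have hlam : ∀ W ∈ s.Ω, W ⊆ (Finset.Ico i t).biUnion p ∨
      Disjoint W ((Finset.Ico i t).biUnion p) := by
    intro W hW
    rcases h.node_subset_or_disjoint hs hW with ⟨a, h1, h2, h3⟩ | hd
    · exact Or.inl (h3.trans (h.subset h1 h2))
    · exact Or.inr hd
  constructor
  · intro U hU
    rcases Finset.mem_insert.1 hU with rfl | hU
    · exact h.card_odd hs
    · exact hs.odd U hU
  · exact fun v => Finset.mem_insert_of_mem (hs.single v)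
  · intro U hU W hW
    rcases Finset.mem_insert.1 hU with rfl | hU
    · rcases Finset.mem_insert.1 hW with rfl | hW
      · exact Or.inl subset_rfl
      · rcases hlam W hW with h1 | h1
        · exact Or.inr (Or.inl h1)
        · exact Or.inr (Or.inr h1.symm)
    · rcases Finset.mem_insert.1 hW with rfl | hW
      · rcases hlam U hU with h1 | h1
        · exact Or.inl h1
        · exact Or.inr (Or.inr h1)
      · exact hs.laminar U hU W hW
  · intro U hU hcard
    rcases Finset.mem_insert.1 hU with rfl | hU
    · have : (s.shrunk i t p e).circ ((Finset.Ico i t).biUnion p) =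
        ⟨t - i, fun j => p (i + j), fun j => e (i + j)⟩ := Function.update_self _ _ _
      rw [this]
      exact h.isBlossom hs
    · rw [h.circ_of_mem hU]
      obtain ⟨h1, h2, h3, h4, h5, h6, h7⟩ := hs.blossom U hU hcard
      refine ⟨h1, h2, fun j hj => Finset.mem_insert_of_mem (h3 j hj), h4, h5, h6, ?_⟩
      intro W hW hss
      rcases Finset.mem_insert.1 hW with rfl | hW
      · exact absurd hss.1 (h.not_subset hU)
      · exact h7 W hW hss

theorem IsFlower.isNode_shrunk (h : IsFlower G w s i t p e) (hs : s.WellNested) {U : Finset V}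
    (hU : (s.shrunk i t p e).IsNode U) : U = (Finset.Ico i t).biUnion p ∨
      s.IsNode U ∧ Disjoint U ((Finset.Ico i t).biUnion p) := by
  rcases Finset.mem_insert.1 hU.1 with h1 | h1
  · exact Or.inl h1
  right
  refine ⟨⟨h1, fun W hW hUW => hU.2 (Finset.mem_insert_of_mem hW) hUW⟩, ?_⟩
  rcases h.node_subset_or_disjoint hs h1 with ⟨a, h2, h3, h4⟩ | hd
  · refine absurd (hU.2 (Finset.mem_insert_self _ _) (h4.trans (h.subset h2 h3))) ?_
    exact h.not_subset h1
  · exact hd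

/-- Any edge that stays in the matching and meets the new blossom enters it at its base. -/
theorem IsFlower.inCut_base (h : IsFlower G w s i t p e) (hs : s.WellNested) (hM : s.IsMatching)
    {f : Sym2 V} (hf : f ∈ (s.shrunk i t p e).M) {x : V} (hx : x ∈ f)
    (hxU : x ∈ (Finset.Ico i t).biUnion p) : x ∈ p i ∧ InCut f (p i) := by
  obtain ⟨a, ha, hxa⟩ := Finset.mem_biUnion.1 hxU
  rw [Finset.mem_Ico] at ha
  obtain ⟨hfM, hfP⟩ := Finset.mem_sdiff.1 hf
  have hc := hM.inCut _ (h.walk.node a ha.2.le) f hfM x hx hxa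
  rcases ha.1.eq_or_lt with rfl | hia
  · exact ⟨hxa, hc⟩
  exfalso
  obtain ⟨b, rfl⟩ : ∃ b, a = b + 1 := ⟨a - 1, by omega⟩
  rcases h.walk.eq_of_inCut hs hM ha.2 hfM hc with rfl | rfl
  · exact hfP (Finset.mem_image_of_mem e (Finset.mem_Ico.2 ⟨by omega, by omega⟩))
  · exact hfP (Finset.mem_image_of_mem e (Finset.mem_Ico.2 ⟨by omega, by omega⟩))

/-- Remaining matching edges that meet the new blossom do so in its base node, so uniqueness there
gives uniqueness for the blossom. -/
theorem IsFlower.isMatching (h : IsFlower G w s i t p e) (hs : s.WellNested) (hM : s.IsMatching) :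
    (s.shrunk i t p e).IsMatching := by
  constructor
  · intro U hU f hf x hx hxU
    rcases h.isNode_shrunk hs hU with rfl | ⟨hU', -⟩
    · obtain ⟨hxp, hc⟩ := h.inCut_base hs hM hf hx hxU
      -- The outer end cannot lie elsewhere in the blossom: every end inside it lies in `p i`.
      obtain ⟨a, ha, b, hb, rfl⟩ := hc
      refine ⟨a, h.subset le_rfl h.lt ha, b, fun hbU => hb ?_, rfl⟩
      exact (h.inCut_base hs hM hf (Sym2.mem_mk_right a b) hbU).1
    · exact hM.inCut U hU' f (Finset.mem_sdiff.1 hf).1 x hx hxU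
  · intro U hU f hf g hg hfU hgU
    have hf' := (Finset.mem_sdiff.1 hf).1
    have hg' := (Finset.mem_sdiff.1 hg).1
    rcases h.isNode_shrunk hs hU with rfl | ⟨hU', -⟩
    · obtain ⟨x, hx, hxU⟩ := hfU.exists_mem
      obtain ⟨y, hy, hyU⟩ := hgU.exists_mem
      exact hM.unique _ (h.walk.node i h.lt.le) f hf' g hg' (h.inCut_base hs hM hf hx hxU).2
        (h.inCut_base hs hM hg hy hyU).2
    · exact hM.unique U hU' f hf' g hg' hfU hgU

theorem IsFlower.mem_biUnion_of_mem (h : IsFlower G w s i t p e) {a : ℕ} (hia : i ≤ a)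
    (hat : a < t) {x : V} (hx : x ∈ e a) : x ∈ (Finset.Ico i t).biUnion p := by
  rcases Joins.mem_or_mem (h.walk.joins a hat) hx with hx | hx
  · exact h.subset hia hat hx
  · rcases (show a + 1 ≤ t from hat).lt_or_eq with h1 | h1
    · exact h.subset (by omega) h1 hx
    · rw [h1, h.close] at hx
      exact h.subset le_rfl h.lt hx

/-- With a nonempty stem, the last stem edge has odd index, hence is in `M`; it survives and covers
the blossom. So an unmatched blossom has an empty stem, and its base is the unmatched start of the
walk. -/
theorem IsFlower.unmatched_shrunk (h : IsFlower G w s i t p e) (hs : s.WellNested)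
    {U : Finset V} (hU : (s.shrunk i t p e).Unmatched U) :
    s.Unmatched U ∨ U = (Finset.Ico i t).biUnion p ∧ s.Unmatched (p i) := by
  rcases h.isNode_shrunk hs hU.1 with rfl | ⟨hU', hd⟩
  · refine Or.inr ⟨rfl, ?_⟩
    rcases i with _ | i
    · exact h.unmatched
    exfalso
    have hi := h.lt
    have hm : e i ∈ s.M := (h.walk.mem_iff_odd hs h.unmatched (by omega)).2 <| by
      have := h.even
      rwa [Nat.even_add_one, Nat.not_even_iff_odd] at this
    obtain ⟨x, hx, y, hy, hxy⟩ := h.walk.joins i (by omega)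
    have hxU : x ∉ (Finset.Ico (i + 1) t).biUnion p := by
      intro hxU
      obtain ⟨a, ha, hxa⟩ := Finset.mem_biUnion.1 hxU
      rw [Finset.mem_Ico] at ha
      exact Finset.disjoint_left.1 (h.disjoint hs (by omega) ha.2 (by omega : i ≠ a)) hx hxa
    refine hU.2 (e i) (Finset.mem_sdiff.2 ⟨hm, fun hP => ?_⟩)
      ⟨y, h.subset le_rfl h.lt hy, x, hxU, hxy.trans Sym2.eq_swap⟩
    obtain ⟨a, ha, hae⟩ := Finset.mem_image.1 hP
    rw [Finset.mem_Ico] at ha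
    refine hxU (h.mem_biUnion_of_mem ha.1 ha.2 ?_)
    rw [hae, hxy]
    exact Sym2.mem_mk_left x y
  · refine Or.inl ⟨hU', fun f hf hc => ?_⟩
    refine hU.2 f (Finset.mem_sdiff.2 ⟨hf, fun hP => ?_⟩) hc
    obtain ⟨a, ha, rfl⟩ := Finset.mem_image.1 hP
    rw [Finset.mem_Ico] at ha
    obtain ⟨x, hx, hxU⟩ := hc.exists_mem
    exact Finset.disjoint_left.1 hd hxU (h.mem_biUnion_of_mem ha.1 ha.2 hx)

end Shrink

/-! ### Base vertices within a nested family -/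

/-- The descent to the base stays inside `Ω`, so circuits recorded for other sets are irrelevant. -/
theorem _root_.Edmonds.IsBase.of_circ_eq {s : State V} (hs : s.WellNested)
    {c : Finset V → Circuit V} (hc : ∀ W ∈ s.Ω, c W = s.circ W) {U : Finset V} {v : V}
    (h : IsBase c U v) (hU : U ∈ s.Ω) : IsBase s.circ U v := by
  induction h with
  | single v => exact .single v
  | blossom U v hcard h ih =>
    rw [hc U hU] at ih
    have hb := hs.blossom U hU hcard
    exact .blossom U v hcard (ih (hb.node_mem 0 (by have := hb.one_lt; omega)))

theorem WellNested.mem_of_isBase {s : State V} (hs : s.WellNested) {U : Finset V} {v : V}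
    (h : IsBase s.circ U v) (hU : U ∈ s.Ω) : v ∈ U := by
  induction h with
  | single v => exact Finset.mem_singleton_self v
  | blossom U v hcard h ih =>
    have hb := hs.blossom U hU hcard
    have h0 : 0 < (s.circ U).len := by have := hb.one_lt; omega
    exact hb.node_subset h0 (ih (hb.node_mem 0 h0))

/-! ### Deshrinking -/

theorem WellNested.node_ne {s : State V} {U : Finset V} (hs : s.WellNested) (hU : U ∈ s.Ω)
    (hcard : 3 ≤ U.card) {j : ℕ} (hj : j < (s.circ U).len) : (s.circ U).node j ≠ U := by
  intro heq
  have hb := hs.blossom U hU hcard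
  have h1 := hb.one_lt
  obtain ⟨l, hl, hlj⟩ : ∃ l < (s.circ U).len, j ≠ l := by
    by_cases h0 : j = 0
    · exact ⟨1, h1, by omega⟩
    · exact ⟨0, by omega, h0⟩
  obtain ⟨x, hx⟩ := hs.nonempty (hb.node_mem l hl)
  exact Finset.disjoint_left.1 (hb.disjoint j hj l hl hlj) (heq.symm.subset (hb.node_subset hl hx))
    hx

/-- A matching edge that meets the node `U` to be deshrunk meets it in the circuit node that the new
matching edges avoid. -/
theorem index_eq_of_mem {s : State V} {U : Finset V} (hs : s.WellNested) (hM : s.IsMatching)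
    (hU : s.IsNode U) (hcard : 3 ≤ U.card) {j : ℕ} (hj : j < (s.circ U).len)
    (h : (∃ e ∈ s.M, ∃ x ∈ U, ∃ y, y ∉ U ∧ e = s(x, y) ∧ x ∈ (s.circ U).node j) ∨
      (s.Unmatched U ∧ j = 0)) {f : Sym2 V} (hf : f ∈ s.M) {x : V} (hx : x ∈ f) {l : ℕ}
    (hl : l < (s.circ U).len) (hxl : x ∈ (s.circ U).node l) : l = j := by
  have hb := hs.blossom U hU.1 hcard
  have hxU := hb.node_subset hl hxl
  have hfU := hM.inCut U hU f hf x hx hxU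
  rcases h with ⟨g, hg, a, ha, b, hbU, rfl, haj⟩ | ⟨hun, -⟩
  · have hgU : InCut s(a, b) U := ⟨a, ha, b, hbU, rfl⟩
    obtain rfl := hM.unique U hU f hf _ hg hfU hgU
    obtain rfl := hgU.eq_of_mem hx (Sym2.mem_mk_left a b) hxU ha
    by_contra hne
    exact Finset.disjoint_left.1 (hb.disjoint l hl j hj hne) hxl haj
  · exact absurd hfU (hun.2 f hf)

section Deshrink

variable [DecidableEq V] {s s' : State V} {U : Finset V}

theorem WellNested.deshrink (hs : s.WellNested) (h : Deshrink U s s') : s'.WellNested := by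
  obtain ⟨hU, hcard, j, -, -, rfl⟩ := h
  constructor
  · exact fun W hW => hs.odd W (Finset.mem_of_mem_erase hW)
  · intro v
    refine Finset.mem_erase.2 ⟨?_, hs.single v⟩
    rintro rfl
    simp at hcard
  · exact fun A hA B hB =>
      hs.laminar A (Finset.mem_of_mem_erase hA) B (Finset.mem_of_mem_erase hB)
  · intro W hW hWc
    obtain ⟨hWU, hW⟩ := Finset.mem_erase.1 hW
    have hb := hs.blossom W hW hWc
    refine ⟨hb.odd, hb.one_lt, fun l hl => Finset.mem_erase.2 ⟨fun h' => hWU ?_, hb.node_mem l hl⟩,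
      hb.disjoint, hb.mem_iff, hb.joins, fun A hA => hb.maximal A (Finset.mem_of_mem_erase hA)⟩
    -- As `U` is maximal, it cannot be a circuit node of another blossom.
    exact (hU.eq_of_le hW (h' ▸ hb.node_subset hl)).symm

theorem isNode_of_deshrink (hs : s.WellNested) (h : Deshrink U s s') {W : Finset V}
    (hW : s'.IsNode W) :
    s.IsNode W ∧ W ≠ U ∨ ∃ j < (s.circ U).len, W = (s.circ U).node j := by
  obtain ⟨hU, hcard, j, -, -, rfl⟩ := h
  obtain ⟨hWU, hWΩ⟩ := Finset.mem_erase.1 hW.1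
  have hb := hs.blossom U hU.1 hcard
  by_cases hsub : W ⊆ U
  · obtain ⟨l, hl, hWl⟩ := hb.maximal W hWΩ (hsub.ssubset_of_ne hWU)
    refine Or.inr ⟨l, hl, hW.eq_of_le ?_ hWl⟩
    exact Finset.mem_erase.2 ⟨hs.node_ne hU.1 hcard hl, hb.node_mem l hl⟩
  · refine Or.inl ⟨⟨hWΩ, fun A hA hWA => ?_⟩, hWU⟩
    by_cases hAU : A = U
    · exact absurd (hAU ▸ hWA) hsub
    · exact hW.2 (Finset.mem_erase.2 ⟨hAU, hA⟩) hWA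

theorem isNode_node_of_deshrink (hs : s.WellNested) (h : Deshrink U s s') {j : ℕ}
    (hj : j < (s.circ U).len) : s'.IsNode ((s.circ U).node j) := by
  have hs' := hs.deshrink h
  have hU := h.1
  have hb := hs.blossom U hU.1 h.2.1
  have hmem : ∀ l < (s.circ U).len, (s.circ U).node l ∈ s'.Ω := by
    obtain ⟨-, hcard, -, -, -, rfl⟩ := h
    exact fun l hl => Finset.mem_erase.2 ⟨hs.node_ne hU.1 hcard hl, hb.node_mem l hl⟩
  obtain ⟨W, hW, hjW⟩ := exists_isNode_of_mem (hmem j hj)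
  obtain ⟨x, hx⟩ := hs'.nonempty (hmem j hj)
  rcases isNode_of_deshrink hs h hW with ⟨hW', hne⟩ | ⟨l, hl, rfl⟩
  · exact absurd (hs.node_eq hW' hU (hjW hx) (hb.node_subset hj hx)) hne
  · by_cases hjl : j = l
    · rwa [hjl]
    · exact absurd (hjW hx) (Finset.disjoint_left.1 (hb.disjoint j hj l hl hjl) hx)

/-- The circuit of the blossom, rotated so that the node avoided by the matching comes last. -/
theorem _root_.Edmonds.IsBlossom.exists_rotation {Ω : Finset (Finset V)} {C : Circuit V}
    {U : Finset V} (h : IsBlossom Ω C U) {j : ℕ} (hj : j < C.len) :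
    ∃ (m : ℕ) (r : ℕ → ℕ) (E : ℕ → Sym2 V), (∀ d, r d < C.len) ∧ r (2 * m) = j ∧
      (∀ a ≤ 2 * m, ∀ b ≤ 2 * m, r a = r b → a = b) ∧
      (∀ l < C.len, ∃ d ≤ 2 * m, r d = l) ∧
      C.matchingAvoiding j = (Finset.range m).image E ∧
      ∀ a < m, Joins (E a) (C.node (r (2 * a))) (C.node (r (2 * a + 1))) := by
  obtain ⟨m, hm⟩ := h.odd
  have hpos : 0 < C.len := by omega
  refine ⟨m, fun d => (j + 1 + d) % C.len, fun a => C.edge ((j + 1 + 2 * a) % C.len),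
    fun d => Nat.mod_lt _ hpos, ?_, ?_, ?_, ?_, ?_⟩
  · show (j + 1 + 2 * m) % C.len = j
    rw [show j + 1 + 2 * m = j + C.len by omega, Nat.add_mod_right, Nat.mod_eq_of_lt hj]
  · intro a ha b hb hab
    have h1 : a ≡ b [MOD C.len] := Nat.ModEq.add_left_cancel' (j + 1) hab
    exact Nat.ModEq.eq_of_lt_of_lt h1 (by omega) (by omega)
  · intro l hl
    rcases Nat.lt_or_ge j l with h1 | h1
    · refine ⟨l - (j + 1), by omega, ?_⟩
      show (j + 1 + (l - (j + 1))) % C.len = l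
      rw [Nat.add_sub_cancel' h1, Nat.mod_eq_of_lt hl]
    · refine ⟨l + C.len - (j + 1), by omega, ?_⟩
      show (j + 1 + (l + C.len - (j + 1))) % C.len = l
      rw [Nat.add_sub_cancel' (by omega), Nat.add_mod_right, Nat.mod_eq_of_lt hl]
  · rw [Circuit.matchingAvoiding, show C.len / 2 = m by omega]
  · intro a _
    have h1 := h.joins ((j + 1 + 2 * a) % C.len) (Nat.mod_lt _ hpos)
    rw [Nat.mod_add_mod] at h1
    exact h1

/-- In the rotated circuit the new edges pair positions `2a` and `2a + 1`, leaving only position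
`2m`, the avoided node. Old edges meeting `U` enter exactly there, so each circuit node sees edges
of one kind only, and the avoided node is uncovered only if `U` was. -/
theorem deshrink_edges (hs : s.WellNested) (hM : s.IsMatching) (h : Deshrink U s s') :
    s'.IsMatching ∧ ∀ W, s'.Unmatched W →
      s.Unmatched W ∨ s.Unmatched U ∧ W = (s.circ U).node 0 := by
  have hs' := hs.deshrink h
  have hnode := fun W => isNode_of_deshrink hs h (W := W)
  have hnode' := fun l => isNode_node_of_deshrink hs h (j := l)
  obtain ⟨hU, hcard, j, hj, hor, rfl⟩ := h
  have hb := hs.blossom U hU.1 hcard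
  have hidx := fun f (hf : f ∈ s.M) x (hx : x ∈ f) l =>
    index_eq_of_mem hs hM hU hcard hj hor hf hx (l := l)
  obtain ⟨m, r, E, hr, hrj, hrinj, hrsurj, hE, hEj⟩ := hb.exists_rotation hj
  simp only [hE] at hs' hnode hnode' ⊢
  have hnodeinj : ∀ a ≤ 2 * m, ∀ b ≤ 2 * m, ∀ x, x ∈ (s.circ U).node (r a) →
      x ∈ (s.circ U).node (r b) → a = b := by
    intro a ha b hb' x hxa hxb
    refine hrinj a ha b hb' ?_
    by_contra hne
    exact Finset.disjoint_left.1 (hb.disjoint _ (hr a) _ (hr b) hne) hxa hxb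
  have hdisj : ∀ a < m, Disjoint ((s.circ U).node (r (2 * a)))
      ((s.circ U).node (r (2 * a + 1))) := fun a ha =>
    Finset.disjoint_left.2 fun x h1 h2 => by
      have := hnodeinj _ (by omega) _ (by omega) x h1 h2
      omega
  have hEU : ∀ a < m, ∀ x ∈ E a, x ∈ U := fun a ha x hx =>
    ((hEj a ha).mem_or_mem hx).elim (fun h => hb.node_subset (hr _) h)
      (fun h => hb.node_subset (hr _) h)
  have hEnode : ∀ a < m, ∀ x ∈ E a, ∀ d ≤ 2 * m, x ∈ (s.circ U).node (r d) →
      d = 2 * a ∨ d = 2 * a + 1 := fun a ha x hx d hd hxd =>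
    ((hEj a ha).mem_or_mem hx).imp (fun h => hnodeinj _ hd _ (by omega) x hxd h)
      (fun h => hnodeinj _ hd _ (by omega) x hxd h)
  refine ⟨⟨?_, ?_⟩, ?_⟩
  · intro W hW f hf x hx hxW
    rcases Finset.mem_union.1 hf with hf | hf
    · rcases hnode W hW with ⟨hW', -⟩ | ⟨l, hl, rfl⟩
      · exact hM.inCut W hW' f hf x hx hxW
      · have hsub := hb.node_subset hl
        exact (hM.inCut U hU f hf x hx (hsub hxW)).mono hsub hx hxW
    · obtain ⟨a, ha, rfl⟩ := Finset.mem_image.1 hf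
      have ha := Finset.mem_range.1 ha
      refine hs'.inCut_of_joins hW (hnode' _ (hr (2 * a))) (hnode' _ (hr (2 * a + 1))) ?_
        (hEj a ha) hx hxW
      intro heq
      obtain ⟨y, hy⟩ := hs.nonempty (hb.node_mem _ (hr (2 * a)))
      exact Finset.disjoint_left.1 (hdisj a ha) hy (heq ▸ hy)
  · intro W hW f hf g hg hfW hgW
    rcases hnode W hW with ⟨hW', hne⟩ | ⟨l, hl, rfl⟩
    · have old : ∀ f ∈ s.M ∪ (Finset.range m).image E, InCut f W → f ∈ s.M := by
        intro f hf hfW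
        rcases Finset.mem_union.1 hf with hf | hf
        · exact hf
        · obtain ⟨a, ha, rfl⟩ := Finset.mem_image.1 hf
          obtain ⟨x, hx, hxW⟩ := hfW.exists_mem
          exact absurd (hs.node_eq hW' hU hxW (hEU a (Finset.mem_range.1 ha) x hx)) hne
      exact hM.unique W hW' f (old f hf hfW) g (old g hg hgW) hfW hgW
    · obtain ⟨d, hd, rfl⟩ := hrsurj l hl
      -- Position `2m` admits only old edges, position `d < 2m` only `E (d / 2)`.
      have alt : ∀ f ∈ s.M ∪ (Finset.range m).image E, InCut f ((s.circ U).node (r d)) →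
          f ∈ s.M ∧ InCut f U ∧ d = 2 * m ∨ f = E (d / 2) ∧ d < 2 * m := by
        intro f hf hc
        obtain ⟨x, hx, hxW⟩ := hc.exists_mem
        rcases Finset.mem_union.1 hf with hf | hf
        · refine Or.inl ⟨hf, hM.inCut U hU f hf x hx (hb.node_subset hl hxW), ?_⟩
          exact hrinj _ hd _ le_rfl ((hidx f hf x hx _ hl hxW).trans hrj.symm)
        · obtain ⟨a, ha, rfl⟩ := Finset.mem_image.1 hf
          have ha := Finset.mem_range.1 ha
          have h1 := hEnode a ha x hx d hd hxW
          exact Or.inr ⟨congrArg E (by omega), by omega⟩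
      rcases alt f hf hfW with ⟨hf1, hf2, hf3⟩ | ⟨hf1, hf2⟩ <;>
        rcases alt g hg hgW with ⟨hg1, hg2, hg3⟩ | ⟨hg1, hg2⟩
      · exact hM.unique U hU f hf1 g hg1 hf2 hg2
      · omega
      · omega
      · rw [hf1, hg1]
  · intro W hW
    rcases hnode W hW.1 with ⟨hW', hne⟩ | ⟨l, hl, rfl⟩
    · exact Or.inl ⟨hW', fun f hf => hW.2 f (Finset.mem_union_left _ hf)⟩
    · right
      obtain ⟨d, hd, rfl⟩ := hrsurj l hl
      have hd2 : d = 2 * m := by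
        by_contra hne
        have ha : d / 2 < m := by omega
        refine hW.2 (E (d / 2))
          (Finset.mem_union_right _ (Finset.mem_image_of_mem E (Finset.mem_range.2 ha))) ?_
        rcases Nat.even_or_odd' d with ⟨a, h1 | h1⟩
        · have h2 : d / 2 = a := by omega
          rw [h2] at ha ⊢
          rw [h1]
          exact (hEj a ha).inCut_left (hdisj a ha)
        · have h2 : d / 2 = a := by omega
          rw [h2] at ha ⊢
          rw [h1]
          exact (hEj a ha).inCut_right (hdisj a ha)
      rw [hd2, hrj] at hW ⊢
      -- A matching edge covering `U` would cover the avoided node; hence `U` was unmatched and that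
      -- node is the base.
      rcases hor with ⟨f, hf, x, hxU, y, hy, rfl, hxj⟩ | ⟨hun, h0⟩
      · exact absurd ⟨x, hxj, y, fun h => hy (hb.node_subset hj h), rfl⟩
          (hW.2 _ (Finset.mem_union_left _ hf))
      · exact ⟨hun, by rw [h0]⟩

theorem WellNested.exists_deshrink (hs : s.WellNested) (hU : s.IsNode U) (hcard : 3 ≤ U.card) :
    ∃ s', Deshrink U s s' := by
  have hb := hs.blossom U hU.1 hcard
  by_cases hun : s.Unmatched U
  · exact ⟨_, hU, hcard, 0, by have := hb.one_lt; omega, Or.inr ⟨hun, rfl⟩, rfl⟩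
  · have : ∃ e ∈ s.M, InCut e U := by
      by_contra! hcon
      exact hun ⟨hU, hcon⟩
    obtain ⟨e, he, x, hx, y, hy, hxy⟩ := this
    obtain ⟨j, hj, hxj⟩ := (hb.mem_iff x).1 hx
    exact ⟨_, hU, hcard, j, hj, Or.inl ⟨e, he, x, hx, y, hy, hxy, hxj⟩, rfl⟩

/-- Each deshrinking removes a set from `Ω`, and any non-singleton member lies below a node that can
be deshrunk. -/
theorem WellNested.exists_expands (hs : s.WellNested) : ∃ N, s.Expands N := by
  induction hn : s.Ω.card using Nat.strong_induction_on generalizing s with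
  | _ n ih =>
    by_cases hall : ∀ U ∈ s.Ω, U.card = 1
    · exact ⟨s.M, s, .refl, hall, rfl⟩
    · push Not at hall
      obtain ⟨A, hA, hA1⟩ := hall
      obtain ⟨U, hU, hAU⟩ := exists_isNode_of_mem hA
      have hcard : 3 ≤ U.card := by
        have h1 := Finset.card_le_card hAU
        obtain ⟨a, ha⟩ := hs.odd A hA
        obtain ⟨b, hb⟩ := hs.odd U hU.1
        omega
      obtain ⟨s', h⟩ := hs.exists_deshrink hU hcard
      have hlt : s'.Ω.card < n := by
        obtain ⟨-, -, -, -, -, rfl⟩ := h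
        rw [← hn]
        exact Finset.card_erase_lt_of_mem hU.1
      obtain ⟨N, t, h1, h2, h3⟩ := ih _ hlt (hs.deshrink h) rfl
      exact ⟨N, t, .head ⟨U, h⟩ h1, h2, h3⟩

end Deshrink

/-! ### The accumulated dual values -/

section Dual

variable [Fintype V] [DecidableEq V] {G : SimpleGraph V} {w : Sym2 V → ℝ} {s s' : State V}

/-- The accumulated dual values are at most `B`, with equality at the bases of unmatched nodes. -/
structure IsBound (s : State V) (B : ℝ) : Prop where
  wellNested : s.WellNested
  isMatching : s.IsMatching
  le : ∀ v, accDual s.π v ≤ B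
  eq : ∀ U, s.Unmatched U → ∀ v, IsBase s.circ U v → accDual s.π v = B

theorem IsBound.augment {B : ℝ} (hB : s.IsBound B) (h : Augment G w s s') : s'.IsBound B := by
  have hM := hB.isMatching.augment hB.wellNested h
  have hun := fun U => Unmatched.of_augment hB.wellNested h (U := U)
  obtain ⟨k, p, e, -, -, -, -, rfl⟩ := h
  exact ⟨hB.wellNested.of_eq rfl rfl, hM, hB.le, fun U hU => hB.eq U (hun U hU)⟩

theorem IsBound.shrink {B : ℝ} (hB : s.IsBound B) (h : Shrink G w s s') : s'.IsBound B := by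
  obtain ⟨i, t, p, e, h1, h2, h3, h4, h5, h6, h7, rfl⟩ := h
  have hf : IsFlower G w s i t p e := ⟨h1, h2, h3, h4, h5, h6, h7⟩
  have hs := hB.wellNested
  change (s.shrunk i t p e).IsBound B
  refine ⟨hf.wellNested hs, hf.isMatching hs hB.isMatching, hB.le, fun U hU v hv => ?_⟩
  have hbase : ∀ W ∈ s.Ω, IsBase (s.shrunk i t p e).circ W v → IsBase s.circ W v :=
    fun W hW hWv => hWv.of_circ_eq hs (fun A hA => hf.circ_of_mem hA) hW
  rcases hf.unmatched_shrunk hs hU with hU' | ⟨rfl, hU'⟩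
  · exact hB.eq U hU' v (hbase U hU'.1.1 hv)
  · refine hB.eq _ hU' v (hbase _ hU'.1.1 ?_)
    generalize hA : (Finset.Ico i t).biUnion p = A at hv
    cases hv with
    | single =>
      -- The new blossom is no singleton, since all singletons were already in `Ω`.
      exact absurd (hs.single v) (hA ▸ hf.notMem)
    | blossom _ _ _ h =>
      rw [← hA] at h
      have hc : (s.shrunk i t p e).circ ((Finset.Ico i t).biUnion p) =
        ⟨t - i, fun j => p (i + j), fun j => e (i + j)⟩ := Function.update_self _ _ _
      rw [hc] at h
      exact h

theorem IsBound.deshrink {B : ℝ} (hB : s.IsBound B) {U : Finset V} (h : Deshrink U s s') :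
    s'.IsBound B := by
  have hs' := hB.wellNested.deshrink h
  obtain ⟨hM, hun⟩ := deshrink_edges hB.wellNested hB.isMatching h
  obtain ⟨-, hcard, j, -, -, rfl⟩ := h
  refine ⟨hs', hM, hB.le, fun W hW v hv => ?_⟩
  rcases hun W hW with hW' | ⟨hU, rfl⟩
  · exact hB.eq W hW' v hv
  · exact hB.eq U hU v (.blossom U v hcard hv)

/-- Changing the dual values on nodes only, the accumulated dual value of a vertex changes by the
amount for its node. -/
theorem WellNested.accDual_sub (hs : s.WellNested) {π' : Finset V → ℝ}
    (hπ : ∀ U, ¬ s.IsNode U → π' U = s.π U) {U : Finset V} (hU : s.IsNode U) {v : V}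
    (hv : v ∈ U) : accDual π' v - accDual s.π v = π' U - s.π U := by
  rw [accDual, accDual, ← Finset.sum_sub_distrib]
  refine Finset.sum_eq_single_of_mem U
    (Finset.mem_filter.2 ⟨Finset.mem_univ U, hs.odd U hU.1, hv⟩) fun W hW hne => ?_
  by_cases hWn : s.IsNode W
  · exact absurd (hs.node_eq hWn hU (Finset.mem_filter.1 hW).2.2 hv) hne
  · rw [hπ W hWn, sub_self]

theorem IsBound.dualUpdate {B : ℝ} (hB : s.IsBound B) (h : DualUpdate G w s s') {α : ℝ}
    (hα : ∀ U, InT G w s U → s'.π U = s.π U + α) : ∃ B', s'.IsBound B' := by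
  obtain ⟨-, ε, π', hε, hT, hS, hN, -, -, rfl⟩ := h
  have hs := hB.wellNested
  have hnode : ∀ U, ¬ s.IsNode U → π' U = s.π U := fun U hU => hN U
    (fun ⟨k, p, e, hp, _, hk, _⟩ => hU (hk ▸ hp.node k le_rfl))
    (fun ⟨k, p, e, hp, _, hk, _⟩ => hU (hk ▸ hp.node k le_rfl))
  have hs' : State.WellNested { s with π := π' } := hs.of_eq rfl rfl
  have hM' : State.IsMatching { s with π := π' } := ⟨hB.isMatching.inCut, hB.isMatching.unique⟩
  by_cases hX : ∃ U, s.Unmatched U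
  · obtain ⟨X, hX⟩ := hX
    have hX' := hs.inT_of_unmatched (G := G) (w := w) hX
    -- An unmatched node lies in 𝒯, so `α` is one of the nonnegative amounts `ε`; nodes outside 𝒯
    -- therefore rise by at most `α`.
    have hα0 : 0 ≤ α := by
      have h1 := hα X hX'
      have h2 := hT X hX'
      have h3 := hε X
      dsimp only at h1
      linarith
    refine ⟨B + α, hs', hM', fun v => ?_, fun U hU v hv => ?_⟩
    · obtain ⟨U, hU, hvU⟩ := hs.exists_isNode v
      have h1 := hs.accDual_sub hnode hU hvU
      have h2 := hB.le v
      have h3 := hε U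
      have h4 : π' U ≤ s.π U + α := by
        by_cases hUT : InT G w s U
        · exact (hα U hUT).le
        · by_cases hUS : InS G w s U
          · rw [hS U hUS]
            linarith
          · rw [hN U hUT hUS]
            linarith
      dsimp only
      linarith
    · have hU : s.Unmatched U := hU
      have h1 := hs.accDual_sub hnode hU.1 (hs.mem_of_isBase hv hU.1.1)
      have h2 := hB.eq U hU v hv
      have h3 : π' U = s.π U + α := hα U (hs.inT_of_unmatched hU)
      dsimp only
      linarith
  -- Without unmatched nodes no path starts, so 𝒮 and 𝒯 are empty and nothing changes.
  · have hπ : π' = s.π := funext fun U => hN U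
      (fun ⟨_, _, _, _, h0, _⟩ => hX ⟨_, h0⟩) (fun ⟨_, _, _, _, h0, _⟩ => hX ⟨_, h0⟩)
    subst hπ
    exact ⟨B, hB⟩

theorem isBound_initial {β : ℝ} (h : s.IsInitial G w) (h1 : ∀ v, s.π {v} = β)
    (h3 : ∀ U : Finset V, 3 ≤ U.card → s.π U = 0) : s.IsBound β := by
  have hmem : ∀ U, U ∈ s.Ω ↔ ∃ v, {v} = U := by
    intro U
    simp [h.sets]
  have hacc : ∀ v, accDual s.π v = β := by
    intro v
    rw [accDual, ← h1 v]
    refine Finset.sum_eq_single_of_mem (f := s.π) ({v} : Finset V) (by simp)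
      fun W hW hne => h3 W ?_
    obtain ⟨hodd, hv⟩ := (Finset.mem_filter.1 hW).2
    have hc : W.card ≠ 1 := by
      intro hc
      obtain ⟨u, rfl⟩ := Finset.card_eq_one.1 hc
      exact hne (by rw [Finset.mem_singleton.1 hv])
    obtain ⟨a, ha⟩ := hodd
    omega
  refine ⟨⟨?_, fun v => (hmem _).2 ⟨v, rfl⟩, ?_, ?_⟩, ⟨?_, ?_⟩, fun v => (hacc v).le,
    fun _ _ v _ => hacc v⟩
  · intro U hU
    obtain ⟨v, rfl⟩ := (hmem U).1 hU
    simp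
  · intro U hU W hW
    obtain ⟨v, rfl⟩ := (hmem U).1 hU
    obtain ⟨u, rfl⟩ := (hmem W).1 hW
    by_cases huv : v = u
    · exact Or.inl (by rw [huv])
    · exact Or.inr (Or.inr (Finset.disjoint_singleton.2 huv))
  · intro U hU hcard
    obtain ⟨v, rfl⟩ := (hmem U).1 hU
    simp at hcard
  · intro U _ e he
    simp [h.matching] at he
  · intro U _ e he
    simp [h.matching] at he

theorem IsBound.of_expands {B : ℝ} (hB : s.IsBound B) {N : Finset (Sym2 V)} (hN : s.Expands N)
    {v : V} (hv : ∀ e ∈ N, v ∉ e) : accDual s.π v = B := by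
  obtain ⟨t, hst, ht, rfl⟩ := hN
  have key : t.IsBound B ∧ t.π = s.π := by
    clear ht hv
    induction hst with
    | refl => exact ⟨hB, rfl⟩
    | tail _ h ih =>
      obtain ⟨U, h⟩ := h
      refine ⟨ih.1.deshrink h, ?_⟩
      obtain ⟨-, -, j, -, -, rfl⟩ := h
      exact ih.2
  obtain ⟨htB, hπ⟩ := key
  obtain ⟨U, hU, hvU⟩ := htB.wellNested.exists_isNode v
  obtain ⟨u, rfl⟩ := Finset.card_eq_one.1 (ht U hU.1)
  obtain rfl := Finset.mem_singleton.1 hvU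
  rw [← hπ]
  refine htB.eq {v} ⟨hU, fun e he hc => hv e he ?_⟩ v (.single v)
  obtain ⟨x, hx, hxv⟩ := hc.exists_mem
  rwa [← Finset.mem_singleton.1 hxv]

end Dual

end State

/-! ### The invariant along a run, and the conclusion -/

theorem IsRun.exists_isBound [Fintype V] [DecidableEq V] {G : SimpleGraph V} {w : Sym2 V → ℝ}
    {n : ℕ} {σ : ℕ → State V} (hrun : IsRun G w n σ) (hcond : UniformDuals G w n σ) {k : ℕ}
    (hk : k ≤ n) : ∃ B, (σ k).IsBound B := by
  induction k with
  | zero =>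
    obtain ⟨β, h1, h3⟩ := hcond.init
    exact ⟨β, State.isBound_initial hrun.initial h1 h3⟩
  | succ k ih =>
    obtain ⟨B, hB⟩ := ih (by omega)
    rcases hrun.step k hk with h | h | h | ⟨U, -, h⟩
    · exact ⟨B, hB.augment h⟩
    · exact ⟨B, hB.shrink h⟩
    · obtain ⟨α, hα⟩ := hcond.step k hk h
      exact hB.dualUpdate h hα
    · exact ⟨B, hB.deshrink h⟩

end Edmonds

theorem mainTheorem3 {V : Type*} [Fintype V] [DecidableEq V]
    (G : SimpleGraph V) (w : Sym2 V → ℝ) (n : ℕ) (σ : ℕ → Edmonds.State V)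
    (hrun : Edmonds.IsRun G w n σ) (hcond : Edmonds.UniformDuals G w n σ)
    (k : ℕ) (hk : k ≤ n) :
    (∃ N, (σ k).Expands N) ∧
      ∀ N, (σ k).Expands N → ∀ v : V, (∀ e ∈ N, v ∉ e) →
        Edmonds.accDual (σ k).π v =
          Finset.univ.sup' ⟨v, Finset.mem_univ v⟩ (Edmonds.accDual (σ k).π) := by
  obtain ⟨B, hB⟩ := hrun.exists_isBound hcond hk
  refine ⟨hB.wellNested.exists_expands, fun N hN v hv => ?_⟩
  refine le_antisymm (Finset.le_sup' _ (Finset.mem_univ v)) (Finset.sup'_le _ _ fun u _ => ?_)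
  rw [hB.of_expands hN hv]
  exact hB.le u
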